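/- Let $R=\mathbb Z[h,t]$ be graded by $\deg h=2$, $\deg t=4$, let $R'=\mathbb Z[h^2,t]\subset R$, and let $A=R[X]/(X^2-hX-t)$, $\deg X=2$, be the Frobenius algebra with counit $\epsilon(1)=0$, $\epsilon(X)=1$ and comultiplication $\Delta(1)=1\otimes X+X\otimes 1-h(1\otimes 1)$, $\Delta(X)=X\otimes X+t(1\otimes 1)$. For an oriented link diagram $D$ let $\mathit{CKh}_{h,t}(D)$ be the Khovanov complex of $D$ obtained from $A$; it is a direct sum of tensor powers $A^{\otimes k}$, one for each complete smoothing of $D$, with one factor for each circle. Let $\widehat\sigma_0\colon R\to R$ be the ring involution $r\mapsto(-1)^{\deg(r)/2}r$ ($r$ homogeneous), let $\sigma\colon A\to A$ be the $R$-algebra involution with $\sigma(X)=h-X$, and let $\widehat\sigma_1\colon A\to A$ be the ring involution $x\mapsto(-1)^{\deg(x)/2}\sigma(x)$ ($x$ homogeneous), so that $\widehat\sigma_1(rx)=\widehat\sigma_0(r)\widehat\sigma_1(x)$ and $\widehat\sigma_1(X)=X-h$. Let $\widehat\sigma$ be the map $\mathit{CKh}_{h,t}(D)\to\mathit{CKh}_{h,t}(D)$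 given by $\widehat\sigma_1\otimes\cdots\otimes\widehat\sigma_1$ on every summand $A^{\otimes k}$. Then $\widehat\sigma$ is an $R'$-linear involution of $\mathit{CKh}_{h,t}(D)$ that commutes with the differential. Moreover, let $S\colon D\to D'$ be a link cobordism represented as a movie of link diagrams, that is, a finite sequence of planar isotopies, Reidemeister moves and Morse moves (births, deaths, saddles), and let $\phi_S\colon\mathit{CKh}_{h,t}(D)\to\mathit{CKh}_{h,t}(D')$ be the corresponding cobordism map, the composition of Bar-Natan's maps for the Reidemeister moves, the canonical isomorphisms for the planar isotopies, and the maps given by the unit, the counit, and the multiplication or comultiplication of $A$ for the births, deaths and saddles. Then $$\widehat\sigma\circ\phi_S=\phi_S\circ\widehat\sigma .$$ -/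

import Mathlib

open scoped TensorProduct

noncomputable section

namespace Khov

/-! ## The Frobenius extension -/

/-- The ground ring `ℤ[h, t]`; the variable `0` is `h`, the variable `1` is `t`. -/
abbrev R : Type := MvPolynomial (Fin 2) ℤ

/-- The element `h`, of degree 2. -/
def h : R := MvPolynomial.X 0

/-- The element `t`, of degree 4. -/
def t : R := MvPolynomial.X 1

/-- The subring `ℤ[h², t]` of `ℤ[h, t]`. -/
def R' : Subalgebra ℤ R := Algebra.adjoin ℤ {h ^ 2, t}

/-- The polynomial `X² - hX - t`. -/
def quad : Polynomial R := Polynomial.X ^ 2 - Polynomial.C h * Polynomial.X - Polynomial.C t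

/-- The algebra `A = ℤ[h, t][X] / (X² - hX - t)`. -/
abbrev A : Type := AdjoinRoot quad

/-- The class of the variable `X` in `A`, of degree 2. -/
def X : A := AdjoinRoot.root quad

theorem quad_eq :
    quad = Polynomial.X ^ 2 + (Polynomial.C (-h) * Polynomial.X + Polynomial.C (-t)) := by
  simp only [quad, map_neg]; ring

theorem quad_degree_lt :
    (Polynomial.C (-h) * Polynomial.X + Polynomial.C (-t) : Polynomial R).degree < (2 : ℕ) :=
  lt_of_le_of_lt Polynomial.degree_linear_le (by norm_num)

theorem quad_monic : quad.Monic := by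
  rw [quad_eq]
  exact Polynomial.monic_X_pow_add quad_degree_lt

theorem quad_degree : quad.degree = 2 := by
  rw [quad_eq]
  rw [Polynomial.degree_add_eq_left_of_degree_lt] <;> rw [Polynomial.degree_X_pow]
  · rfl
  · exact quad_degree_lt

theorem X_sq : X ^ 2 = algebraMap R A h * X + algebraMap R A t := by
  have key : AdjoinRoot.mk quad (Polynomial.X ^ 2 - Polynomial.C h * Polynomial.X -
      Polynomial.C t) = 0 := AdjoinRoot.mk_self
  simp only [map_sub, map_mul, map_pow, AdjoinRoot.mk_X, AdjoinRoot.mk_C] at key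
  simp only [X, AdjoinRoot.algebraMap_eq]
  linear_combination key

/-- The coefficient of `X ^ k` of an element of `A` written as `a + bX`. -/
def coeffA (k : ℕ) : A →ₗ[R] R := Polynomial.lcoeff R k ∘ₗ AdjoinRoot.modByMonicHom quad_monic

theorem coeffA_one (k : ℕ) : coeffA k 1 = if k = 0 then 1 else 0 := by
  have e : (Polynomial.modByMonic 1 quad) = 1 :=
    (Polynomial.modByMonic_eq_self_iff quad_monic).2 (by rw [quad_degree]; simp)
  rw [← map_one (AdjoinRoot.mk quad), coeffA, LinearMap.comp_apply,
    AdjoinRoot.modByMonicHom_mk, e, Polynomial.lcoeff_apply, Polynomial.coeff_one]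

theorem coeffA_X (k : ℕ) : coeffA k X = if k = 1 then 1 else 0 := by
  have e : (Polynomial.modByMonic Polynomial.X quad) = Polynomial.X :=
    (Polynomial.modByMonic_eq_self_iff quad_monic).2 (by
      rw [quad_degree, Polynomial.degree_X]; norm_num)
  rw [X, ← AdjoinRoot.mk_X, coeffA, LinearMap.comp_apply,
    AdjoinRoot.modByMonicHom_mk, e, Polynomial.lcoeff_apply, Polynomial.coeff_X]
  simp [eq_comm]

/-- The counit, `ε(1) = 0`, `ε(X) = 1`. -/
def counit : A →ₗ[R] R := coeffA 1

/-- The comultiplication, `Δ(1) = 1 ⊗ X + X ⊗ 1 - h (1 ⊗ 1)`, `Δ(X) = X ⊗ X + t (1 ⊗ 1)`. -/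
def comul : A →ₗ[R] A ⊗[R] A :=
  (coeffA 0).smulRight (1 ⊗ₜ[R] X + X ⊗ₜ[R] 1 - h • (1 ⊗ₜ[R] 1)) +
    (coeffA 1).smulRight (X ⊗ₜ[R] X + t • (1 ⊗ₜ[R] 1))

theorem counit_one : counit 1 = 0 := by simp [counit, coeffA_one]

theorem counit_X : counit X = 1 := by simp [counit, coeffA_X]

theorem comul_one : comul 1 = 1 ⊗ₜ[R] X + X ⊗ₜ[R] 1 - h • (1 ⊗ₜ[R] 1) := by
  simp [comul, coeffA_one]

theorem comul_X : comul X = X ⊗ₜ[R] X + t • (1 ⊗ₜ[R] 1) := by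
  simp [comul, coeffA_X]

/-! ## The involutions on `R` and `A` -/

/-- `σ̂₀`, the ring involution `r ↦ (-1) ^ (deg r / 2) r`: it multiplies the generator `h`, of
degree 2, by `(-1) ^ (2 / 2)`, and the generator `t`, of degree 4, by `(-1) ^ (4 / 2)`. -/
def sigma0 : R →+* R :=
  (MvPolynomial.aeval (R := ℤ) fun k : Fin 2 =>
    (-1 : R) ^ ((![2, 4] : Fin 2 → ℕ) k / 2) * MvPolynomial.X k).toRingHom

theorem sigma0_h : sigma0 h = -h := by simp [sigma0, h]

theorem sigma0_t : sigma0 t = t := by simp [sigma0, t]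

theorem sigma0_monomial (m : Fin 2 →₀ ℕ) (c : ℤ) :
    sigma0 (MvPolynomial.monomial m c) =
      (-1) ^ ((2 * m 0 + 4 * m 1) / 2) * MvPolynomial.monomial m c := by
  have e : (2 * m 0 + 4 * m 1) / 2 = m 0 + 2 * m 1 := by omega
  rw [e, MvPolynomial.monomial_eq, Finsupp.prod_fintype _ _ (by simp)]
  have hc : sigma0 (MvPolynomial.C c) = MvPolynomial.C c := by simp
  have h0 : sigma0 (MvPolynomial.X 0) = -MvPolynomial.X 0 := sigma0_h
  have h1 : sigma0 (MvPolynomial.X 1) = MvPolynomial.X 1 := sigma0_t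
  simp only [map_mul, map_pow, Fin.prod_univ_two, hc, h0, h1, pow_add, pow_mul]
  rw [neg_pow]
  ring_nf

/-- `σ`, the `R`-algebra involution of `A` given by `X ↦ h - X`. -/
def sigma : A →+* A :=
  AdjoinRoot.lift (algebraMap R A) (algebraMap R A h - X) (by
    simp only [quad, Polynomial.eval₂_sub, Polynomial.eval₂_mul, Polynomial.eval₂_pow,
      Polynomial.eval₂_X, Polynomial.eval₂_C]
    linear_combination X_sq)

/-- The sign twist `x ↦ (-1) ^ (deg x / 2) x` on the graded ring `A`: it is `σ̂₀` on scalars and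
multiplies the generator `X`, of degree 2, by `-1`. -/
def degSign : A →+* A :=
  AdjoinRoot.lift ((algebraMap R A).comp sigma0) (-X) (by
    simp only [quad, Polynomial.eval₂_sub, Polynomial.eval₂_mul, Polynomial.eval₂_pow,
      Polynomial.eval₂_X, Polynomial.eval₂_C, RingHom.comp_apply, sigma0_h, sigma0_t, map_neg]
    linear_combination X_sq)

/-- `σ̂₁`, the ring involution `x ↦ (-1) ^ (deg x / 2) σ(x)` of `A`. -/
def sigma1 : A →+* A := sigma.comp degSign

theorem sigma1_X : sigma1 X = X - algebraMap R A h := by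
  have e1 : degSign X = -X := AdjoinRoot.lift_root _
  have e2 : sigma X = algebraMap R A h - X := AdjoinRoot.lift_root _
  rw [sigma1, RingHom.comp_apply, e1, map_neg, e2, neg_sub]

theorem sigma1_algebraMap (r : R) : sigma1 (algebraMap R A r) = algebraMap R A (sigma0 r) := by
  have e1 : degSign (algebraMap R A r) = algebraMap R A (sigma0 r) := AdjoinRoot.lift_of _
  have e2 (u : R) : sigma (algebraMap R A u) = algebraMap R A u := AdjoinRoot.lift_of _
  rw [sigma1, RingHom.comp_apply, e1, e2]

theorem sigma1_smul (r : R) (x : A) : sigma1 (r • x) = sigma0 r • sigma1 x := by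
  rw [Algebra.smul_def, map_mul, sigma1_algebraMap, Algebra.smul_def]

/-! ## Tensor powers and the maps of elementary cobordisms -/

/-- `A ^ {⊗ C}`, one tensor factor for each circle `c : C`. -/
abbrev TP (C : Type) : Type := PiTensorProduct R fun _ : C => A

open Classical in
/-- The inclusion of `A` as the tensor factor of the circle `c`. -/
def single {C : Type} (c : C) : A →ₐ[R] TP C :=
  PiTensorProduct.singleAlgHom (A := fun _ : C => A) c

/-- The linear map `⨂ a_c ↦ ∏ F_c (a_c)`. -/
def prodMap {C : Type} [Finite C] {B : Type} [CommRing B] [Algebra R B] (F : C → A →ₗ[R] B) :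
    TP C →ₗ[R] B :=
  letI := Fintype.ofFinite C
  PiTensorProduct.lift ((MultilinearMap.mkPiAlgebra R C B).compLinearMap F)

/-- For a map `f : C → C'` of sets of circles, the map `A ^ {⊗ C} → A ^ {⊗ C'}` that multiplies the
factors with the same image (merging) and puts the unit at the circles that are not in the image
(births). For bijective `f` it is the permutation of the tensor factors. -/
def mergeBirth {C C' : Type} [Finite C] (f : C → C') : TP C →ₗ[R] TP C' :=
  prodMap fun c => (single (f c)).toLinearMap

open Classical in
/-- For an injection `f : C → C'` of sets of circles, the map `A ^ {⊗ C'} → A ^ {⊗ C}` that applies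
the counit at the circles that are not in the image (deaths), and leaves the other factors alone.
For bijective `f` it is the inverse permutation of the tensor factors. -/
def death {C C' : Type} [Finite C'] (f : C → C') : TP C' →ₗ[R] TP C :=
  prodMap fun c' =>
    if e : ∃ c, f c = c' then (single e.choose).toLinearMap
    else Algebra.linearMap R (TP C) ∘ₗ counit

open Classical in
/-- The map `A ^ {⊗ C} → A ^ {⊗ C'}` that applies the comultiplication at the circle `c₀`, with the
result in the factors `p, q`, and carries the factor of any other circle `c` to that of `f c`. -/
def split {C C' : Type} [Finite C] (f : C → C') (c₀ : C) (p q : C') : TP C →ₗ[R] TP C' :=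
  prodMap fun c =>
    if c = c₀ then
      (Algebra.TensorProduct.productMap (single p) (single q)).toLinearMap ∘ₗ comul
    else (single (f c)).toLinearMap

/-- A copy of `A ^ {⊗ C}` on which a scalar `r` acts as `σ̂₀(r)`. -/
def Twisted (C : Type) : Type := TP C

instance (C : Type) : AddCommMonoid (Twisted C) := (inferInstance : AddCommMonoid (TP C))

instance (C : Type) : Module R (Twisted C) :=
  letI m : Module R (TP C) := inferInstance
  @Module.compHom R R (TP C) _ _ m _ sigma0

/-- The multilinear map `a ↦ ⨂ σ̂₁(a_c)`. -/
def sigmaMultilinear (C : Type) : MultilinearMap R (fun _ : C => A) (Twisted C) where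
  toFun a := PiTensorProduct.tprod R fun c => sigma1 (a c)
  map_update_add' a c x y := by
    have e (z : A) : (fun k => sigma1 (Function.update a c z k)) =
        Function.update (fun k => sigma1 (a k)) c (sigma1 z) :=
      Function.comp_update sigma1 a c z
    rw [e, e, e, map_add]
    exact (PiTensorProduct.tprod R : MultilinearMap R (fun _ : C => A) (TP C)).map_update_add
      (fun k => sigma1 (a k)) c (sigma1 x) (sigma1 y)
  map_update_smul' a c r x := by
    have e (z : A) : (fun k => sigma1 (Function.update a c z k)) =
        Function.update (fun k => sigma1 (a k)) c (sigma1 z) :=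
      Function.comp_update sigma1 a c z
    rw [e, e, sigma1_smul]
    exact (PiTensorProduct.tprod R : MultilinearMap R (fun _ : C => A) (TP C)).map_update_smul
      (fun k => sigma1 (a k)) c (sigma0 r) (sigma1 x)

/-- `σ̂ = σ̂₁ ⊗ ⋯ ⊗ σ̂₁` on a tensor power of `A`. -/
def sigmaTP (C : Type) : TP C →ₛₗ[sigma0] TP C where
  toFun x := PiTensorProduct.lift (sigmaMultilinear C) x
  map_add' x y := map_add (PiTensorProduct.lift (sigmaMultilinear C)) x y
  map_smul' r x := map_smul (PiTensorProduct.lift (sigmaMultilinear C)) r x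

theorem sigmaTP_tprod (C : Type) (a : C → A) :
    sigmaTP C (PiTensorProduct.tprod R a) = PiTensorProduct.tprod R fun c => sigma1 (a c) :=
  PiTensorProduct.lift.tprod (φ := sigmaMultilinear C) a

/-! ## Planar diagrams

A diagram is cut into items, crossings and crossingless arcs, by finitely many points; every point
is an end of exactly two items. -/

/-- A crossing. The four ends `pt 0, …, pt 3` are listed counterclockwise, the lower strand joins
`pt 0` to `pt 2`, the upper strand joins `pt 1` to `pt 3`. The lower strand is directed from `pt 0`
to `pt 2` iff `low`, the upper strand from `pt 1` to `pt 3` iff `up`. -/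
structure Crossing (P : Type) where
  pt : Fin 4 → P
  low : Bool
  up : Bool

/-- A crossingless arc, directed from `pt 0` to `pt 1` iff `dir`. -/
structure Arc (P : Type) where
  pt : Fin 2 → P
  dir : Bool

/-- A finite collection of (ordered) crossings and arcs, with ends in the set of points `P`. -/
structure Piece (P : Type) where
  n : ℕ
  m : ℕ
  crossing : Fin n → Crossing P
  arc : Fin m → Arc P

variable {P Q : Type}

def Crossing.map (f : P → Q) (c : Crossing P) : Crossing Q := ⟨fun k => f (c.pt k), c.low, c.up⟩

/-- The same crossing, with the list of ends started at the other end of the lower strand. -/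
def Crossing.rotate (c : Crossing P) : Crossing P := ⟨fun k => c.pt (k + 2), !c.low, !c.up⟩

/-- The strand enters the crossing at the end number `k`. -/
def Crossing.isIn (c : Crossing P) : Fin 4 → Bool := ![c.low, c.up, !c.low, !c.up]

/-- The crossing is negative. -/
def Crossing.isNegative (c : Crossing P) : Bool := c.low == c.up

def Arc.map (f : P → Q) (a : Arc P) : Arc Q := ⟨fun k => f (a.pt k), a.dir⟩

/-- The same arc, with the ends listed in the other order. -/
def Arc.rotate (a : Arc P) : Arc P := ⟨fun k => a.pt (k + 1), !a.dir⟩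

def Arc.isIn (a : Arc P) : Fin 2 → Bool := ![a.dir, !a.dir]

def Piece.map (f : P → Q) (T : Piece P) : Piece Q :=
  ⟨T.n, T.m, fun c => (T.crossing c).map f, fun k => (T.arc k).map f⟩

/-- The union of two collections; the crossings of the second come last. -/
def Piece.append (S T : Piece P) : Piece P :=
  ⟨S.n + T.n, S.m + T.m, Fin.append S.crossing T.crossing, Fin.append S.arc T.arc⟩

namespace Piece

/-- The ends of the items. -/
abbrev Dart (T : Piece P) : Type := (Fin T.n × Fin 4) ⊕ (Fin T.m × Fin 2)

/-- The point at an end of an item. -/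
def dartPt (T : Piece P) : T.Dart → P :=
  Sum.elim (fun d => (T.crossing d.1).pt d.2) fun d => (T.arc d.1).pt d.2

def dartIsIn (T : Piece P) : T.Dart → Bool :=
  Sum.elim (fun d => (T.crossing d.1).isIn d.2) fun d => (T.arc d.1).isIn d.2

/-- The next end, counterclockwise, of the same item. -/
def dartNext (T : Piece P) : T.Dart → T.Dart :=
  Sum.map (fun d => (d.1, d.2 + 1)) fun d => (d.1, d.2 + 1)

/-- Every point is an end of exactly two items (or is both ends of the same item); one of them is
directed towards the point, the other away from it. -/
def IsClosed (T : Piece P) : Prop :=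
  ∀ p : P, (∃! d : T.Dart, T.dartPt d = p ∧ T.dartIsIn d = true) ∧
    ∃! d : T.Dart, T.dartPt d = p ∧ T.dartIsIn d = false

/-- The connected components of the underlying graph. -/
def Components (T : Piece P) : Type :=
  Quot fun d e : T.Dart => T.dartPt d = T.dartPt e ∨ e = T.dartNext d

/-- The faces of the ribbon graph with the items as vertices and the points as edges. -/
def Faces (T : Piece P) : Type :=
  Quot fun d e : T.Dart => ∃ d' : T.Dart, d' ≠ d ∧ T.dartPt d' = T.dartPt d ∧ e = T.dartNext d'

/-- The ribbon graph with the items as vertices and the points as edges has genus zero: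
`V - E + F` is twice the number of connected components. -/
def IsPlanar (T : Piece P) : Prop :=
  ((T.n + T.m : ℕ) : ℤ) - Nat.card P + Nat.card T.Faces = 2 * Nat.card T.Components

/-- The collection is a planar diagram of an oriented link. -/
def IsLink (T : Piece P) : Prop := T.IsClosed ∧ T.IsPlanar

/-- The number of negative crossings. -/
def nMinus (T : Piece P) : ℕ := (Finset.univ.filter fun c => (T.crossing c).isNegative = true).card

end Piece

/-- The pairs of ends joined by the smoothing of a crossing: the 0-smoothing (`false`) merges the
two regions swept out by turning the upper strand counterclockwise, the 1-smoothing (`true`) merges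
the other two. -/
def Crossing.joins (c : Crossing P) (b : Bool) : List (P × P) :=
  if b then [(c.pt 0, c.pt 3), (c.pt 1, c.pt 2)] else [(c.pt 0, c.pt 1), (c.pt 2, c.pt 3)]

/-- The pairs of points joined by an item in the smoothing `s`. The circles of the smoothing are the
classes of the equivalence relation that this relation generates. -/
def Piece.smoothing (T : Piece P) (s : Fin T.n → Bool) : P → P → Prop := fun x y =>
  (∃ c, (x, y) ∈ (T.crossing c).joins (s c)) ∨ ∃ k, x = (T.arc k).pt 0 ∧ y = (T.arc k).pt 1

/-- A diagram of an oriented link. Diagrams on any finite set of points are allowed; a connected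
component without crossings is made of arcs. -/
structure LinkDiagram where
  P : Type
  [finite : Finite P]
  piece : Piece P
  isLink : piece.IsLink

attribute [instance] LinkDiagram.finite

/-! ## Cobordism maps between crossingless diagrams

A crossingless diagram is given by a relation `r` on a finite set of points, its circles are the
elements of `Quot r`. -/

/-- The state space `A ^ {⊗ circles}`. -/
abbrev StateSpace (r : P → P → Prop) : Type := TP (Quot r)

/-- The map on circles induced by a map `g` on points. -/
def circleMap (g : P → Q) (r : P → P → Prop) (r' : Q → Q → Prop) (c : Quot r) : Quot r' :=
  Quot.mk r' (g c.out)

/-- The choice of a point on the circle in `circleMap` is immaterial as soon as `g` maps circles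
into circles. -/
theorem circleMap_mk (g : P → Q) (r : P → P → Prop) (r' : Q → Q → Prop)
    (H : ∀ x y, r x y → Quot.mk r' (g x) = Quot.mk r' (g y)) (x : P) :
    circleMap g r r' (Quot.mk r x) = Quot.mk r' (g x) := by
  have e : Quot.lift (fun z => Quot.mk r' (g z)) H (Quot.mk r (Quot.mk r x).out) =
      Quot.lift (fun z => Quot.mk r' (g z)) H (Quot.mk r x) := by rw [Quot.out_eq]
  exact e

/-- The isotopy along `g`, together with a birth of the circles of `r'` that `g` does not reach. -/
def pushMap [Finite P] (g : P → Q) (r : P → P → Prop) (r' : Q → Q → Prop) :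
    StateSpace r →ₗ[R] StateSpace r' :=
  mergeBirth (circleMap g r r')

/-- The reverse cobordism: the death of the circles of `r'` that `g` does not reach, together with
the inverse isotopy. -/
def pullMap [Finite Q] (g : P → Q) (r : P → P → Prop) (r' : Q → Q → Prop) :
    StateSpace r' →ₗ[R] StateSpace r :=
  death (circleMap g r r')

open Classical in
/-- The saddle from `r` to `r'`, two relations on the same points that differ by a surgery on two
strands. The points `a` and `c` lie on the two different strands before the surgery, and also on the
two different strands after it. If the strands before belong to two circles, these are merged;
otherwise, the circle is split. (In a planar diagram one of the two cases occurs.) -/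
def saddle [Finite P] (r r' : P → P → Prop) (a c : P) : StateSpace r →ₗ[R] StateSpace r' :=
  if Quot.mk r a ≠ Quot.mk r c then mergeBirth (circleMap id r r')
  else if Quot.mk r' a ≠ Quot.mk r' c then
    split (circleMap id r r') (Quot.mk r a) (Quot.mk r' a) (Quot.mk r' c)
  else 0

/-- Add some joins to a relation. -/
def addJoins (r : P → P → Prop) (l : List (P × P)) : P → P → Prop := fun x y => r x y ∨ (x, y) ∈ l

/-! ## The Khovanov complex -/

/-- The vertices of the cube of resolutions. -/
abbrev LinkDiagram.State (D : LinkDiagram) : Type := Fin D.piece.n → Bool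

/-- The number of ones. -/
def LinkDiagram.weight (D : LinkDiagram) (s : D.State) : ℕ :=
  (Finset.univ.filter fun c => s c = true).card

/-- The relation of a complete smoothing. -/
def LinkDiagram.rel (D : LinkDiagram) (s : D.State) : D.P → D.P → Prop := D.piece.smoothing s

/-- The homological degree `i` part of the Khovanov complex: the direct sum of the state spaces
over the vertices of the cube with `i + n₋` ones. -/
abbrev CKh (D : LinkDiagram) (i : ℤ) : Type :=
  (s : {s : D.State // (D.weight s : ℤ) - D.piece.nMinus = i}) → StateSpace (D.rel s.1)

/-- A matrix of linear maps between the state spaces of two diagrams. -/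
abbrev Mat (D D' : LinkDiagram) : Type :=
  (s : D.State) → (s' : D'.State) → StateSpace (D.rel s) →ₗ[R] StateSpace (D'.rel s')

open Classical in
/-- The linear map given by the entries of a matrix between parts of the given degrees. -/
def Mat.toLin {D D' : LinkDiagram} (M : Mat D D') (i j : ℤ) : CKh D i →ₗ[R] CKh D' j :=
  letI := Fintype.ofFinite {s : D.State // (D.weight s : ℤ) - D.piece.nMinus = i}
  LinearMap.pi fun s' => ∑ s : {s : D.State // (D.weight s : ℤ) - D.piece.nMinus = i},
    M s.1 s'.1 ∘ₗ LinearMap.proj s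

/-- The differential: the entry from `s` to a vertex that arises from `s` by the change of one
coordinate `c` from 0 to 1 is the saddle at the crossing `c`, with sign `-1` to the number of
ones of `s` before `c`. -/
def diffMat (D : LinkDiagram) : Mat D D := fun s s' =>
  ∑ c : Fin D.piece.n,
    if s c = false ∧ s' = Function.update s c true then
      (-1 : ℤ) ^ (Finset.univ.filter fun k => k < c ∧ s k = true).card •
        saddle (D.rel s) (D.rel s') ((D.piece.crossing c).pt 0) ((D.piece.crossing c).pt 2)
    else 0

/-- The differential of the Khovanov complex. -/
def CKh.d (D : LinkDiagram) (i : ℤ) : CKh D i →ₗ[R] CKh D (i + 1) := (diffMat D).toLin i (i + 1)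

/-- The involution `σ̂` on the Khovanov complex, which is `σ̂₁ ⊗ ⋯ ⊗ σ̂₁` on every summand. -/
def CKh.sigma (D : LinkDiagram) (i : ℤ) : CKh D i →ₛₗ[sigma0] CKh D i where
  toFun x s := sigmaTP _ (x s)
  map_add' x y := funext fun s => map_add (sigmaTP _) (x s) (y s)
  map_smul' r x := funext fun s => map_smulₛₗ (sigmaTP _) r (x s)

/-! ## Local pictures -/

/-- A single arc with ends `a`, `b`. -/
def arcPiece (a b : P) (dir : Bool) : Piece P := ⟨0, 1, ![], ![⟨![a, b], dir⟩]⟩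

/-- Two arcs, with ends `a`, `b`, and with ends `c`, `d`. -/
def twoArcs (a b c d : P) (dir₁ dir₂ : Bool) : Piece P :=
  ⟨0, 2, ![], ![⟨![a, b], dir₁⟩, ⟨![c, d], dir₂⟩]⟩

/-- A single crossing with ends `a`, `b`, `c`, `d`. -/
def crossingPiece (a b c d : P) (low up : Bool) : Piece P :=
  ⟨1, 0, ![⟨![a, b, c, d], low, up⟩], ![]⟩

/-- Two strands, from `a` to `b` and from `c` to `d`, the first of which passes over the second in a
bigon; the counterclockwise order of the ends is `a, c, d, b`. The inner points are the midpoints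
of the first and of the second strand. -/
def bigonPiece (a b c d : P) (u₁ o₁ u₂ o₂ : Bool) : Piece (P ⊕ Fin 2) :=
  ⟨2, 0, ![⟨![.inl c, .inr 0, .inr 1, .inl a], u₁, o₁⟩,
    ⟨![.inr 1, .inr 0, .inl d, .inl b], u₂, o₂⟩], ![]⟩

/-- Three strands `0, 1, 2`, the strand `k` from `p k` to `p (k + 3)`, where `p 0, …, p 5` is the
counterclockwise order of the ends. The inner point `k` is the midpoint of the strand `k`. The
strand 0 lies over the other two. The strand 2 lies over the strand 1 if `mid`, and under it
otherwise. If `side = false`, then the crossing of the strands 1 and 2 is on the right of the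
strand `0` directed from `p 3` to `p 0`, that is, on the side of the ends `p 4` and `p 5`; if
`side = true`, then it is on the other side.
The order of the crossings is: 0 with 1, 0 with 2, 1 with 2. -/
def trianglePiece (mid side : Bool) (p : Fin 6 → P) (u o : Fin 3 → Bool) : Piece (P ⊕ Fin 3) :=
  ⟨3, 0,
    ![⟨if side then ![.inr 1, .inl (p 3), .inl (p 4), .inr 0]
        else ![.inl (p 1), .inr 0, .inr 1, .inl (p 0)], u 0, o 0⟩,
      ⟨if side then ![.inr 2, .inr 0, .inl (p 5), .inl (p 0)]
        else ![.inl (p 2), .inl (p 3), .inr 2, .inr 0], u 1, o 1⟩,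
      ⟨match mid, side with
        | true, false => ![.inr 1, .inr 2, .inl (p 4), .inl (p 5)]
        | false, false => ![.inr 2, .inl (p 4), .inl (p 5), .inr 1]
        | true, true => ![.inl (p 1), .inl (p 2), .inr 1, .inr 2]
        | false, true => ![.inl (p 2), .inr 1, .inr 2, .inl (p 1)], u 2, o 2⟩],
    ![]⟩

/-- A planar isotopy of diagrams: a relabelling of the points, the crossings and the arcs. -/
structure Isotopy (D D' : LinkDiagram) where
  point : D.P ≃ D'.P
  cr : Fin D.piece.n ≃ Fin D'.piece.n
  ar : Fin D.piece.m ≃ Fin D'.piece.m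
  crossing_eq : ∀ c, D'.piece.crossing (cr c) = (D.piece.crossing c).map point ∨
    D'.piece.crossing (cr c) = ((D.piece.crossing c).map point).rotate
  arc_eq : ∀ k, D'.piece.arc (ar k) = (D.piece.arc k).map point ∨
    D'.piece.arc (ar k) = ((D.piece.arc k).map point).rotate

/-! ## Elementary moves -/

/-- The elementary moves of link diagrams. The part `O` of the diagram is not changed. Directions
are arbitrary, subject to the condition that the two diagrams are diagrams of oriented links. -/
inductive Elementary : LinkDiagram → LinkDiagram → Type 1
  /-- A planar isotopy. -/
  | isotopy {D D' : LinkDiagram} (e : Isotopy D D') : Elementary D D'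
  /-- A planar isotopy that only adds a point: the point `p` is replaced by an arc from `p` to a
  new point. -/
  | subdivide (P : Type) [Finite P] (O : Piece (P ⊕ Fin 1)) (p : P) (dir : Bool)
      (H : (O.map (Sum.elim id fun _ => p)).IsLink)
      (H' : (O.append (arcPiece (.inl p) (.inr 0) dir)).IsLink) :
      Elementary ⟨P, O.map (Sum.elim id fun _ => p), H⟩
        ⟨P ⊕ Fin 1, O.append (arcPiece (.inl p) (.inr 0) dir), H'⟩
  /-- The first Reidemeister move that makes a kink with a positive crossing. -/
  | posKink (P : Type) [Finite P] (O : Piece P) (a b : P) (dir u o : Bool)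
      (H : (O.append (arcPiece a b dir)).IsLink)
      (H' : ((O.map Sum.inl).append
        (crossingPiece (.inr 0) (.inr 0) (.inl a) (.inl b) u o)).IsLink) :
      Elementary ⟨P, O.append (arcPiece a b dir), H⟩
        ⟨P ⊕ Fin 1, (O.map Sum.inl).append
          (crossingPiece (.inr 0) (.inr 0) (.inl a) (.inl b) u o), H'⟩
  /-- The first Reidemeister move that makes a kink with a negative crossing. -/
  | negKink (P : Type) [Finite P] (O : Piece P) (a b : P) (dir u o : Bool)
      (H : (O.append (arcPiece a b dir)).IsLink)
      (H' : ((O.map Sum.inl).append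
        (crossingPiece (.inl a) (.inr 0) (.inr 0) (.inl b) u o)).IsLink) :
      Elementary ⟨P, O.append (arcPiece a b dir), H⟩
        ⟨P ⊕ Fin 1, (O.map Sum.inl).append
          (crossingPiece (.inl a) (.inr 0) (.inr 0) (.inl b) u o), H'⟩
  /-- The second Reidemeister move that makes a bigon. -/
  | bigon (P : Type) [Finite P] (O : Piece P) (a b c d : P) (dir₁ dir₂ u₁ o₁ u₂ o₂ : Bool)
      (H : (O.append (twoArcs a b c d dir₁ dir₂)).IsLink)
      (H' : ((O.map Sum.inl).append (bigonPiece a b c d u₁ o₁ u₂ o₂)).IsLink) :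
      Elementary ⟨P, O.append (twoArcs a b c d dir₁ dir₂), H⟩
        ⟨P ⊕ Fin 2, (O.map Sum.inl).append (bigonPiece a b c d u₁ o₁ u₂ o₂), H'⟩
  /-- The third Reidemeister move. -/
  | triangle (P : Type) [Finite P] (O : Piece P) (mid side : Bool) (p : Fin 6 → P)
      (u o u' o' : Fin 3 → Bool)
      (H : ((O.map Sum.inl).append (trianglePiece mid side p u o)).IsLink)
      (H' : ((O.map Sum.inl).append (trianglePiece mid (!side) p u' o')).IsLink) :
      Elementary ⟨P ⊕ Fin 3, (O.map Sum.inl).append (trianglePiece mid side p u o), H⟩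
        ⟨P ⊕ Fin 3, (O.map Sum.inl).append (trianglePiece mid (!side) p u' o'), H'⟩
  /-- The birth of a circle. -/
  | cup (P : Type) [Finite P] (O : Piece P) (dir : Bool) (H : O.IsLink)
      (H' : ((O.map Sum.inl).append
        (arcPiece (.inr 0 : P ⊕ Fin 1) (.inr 0) dir)).IsLink) :
      Elementary ⟨P, O, H⟩
        ⟨P ⊕ Fin 1, (O.map Sum.inl).append (arcPiece (.inr 0) (.inr 0) dir), H'⟩
  /-- A saddle. The last condition says that the two arcs, whose ends are `a, b, c, d` in the
  counterclockwise order, are next to each other in the plane. -/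
  | saddle (P : Type) [Finite P] (O : Piece P) (a b c d : P) (dir₁ dir₂ dir₃ dir₄ : Bool)
      (H : (O.append (twoArcs a b c d dir₁ dir₂)).IsLink)
      (H' : (O.append (twoArcs a d b c dir₃ dir₄)).IsLink)
      (planar : (O.append (crossingPiece a b c d true true)).IsPlanar) :
      Elementary ⟨P, O.append (twoArcs a b c d dir₁ dir₂), H⟩
        ⟨P, O.append (twoArcs a d b c dir₃ dir₄), H'⟩

/-- The restriction of a state of a union with `n + k` crossings to the first `n`. -/
def outer (n k : ℕ) (s : Fin (n + k) → Bool) : Fin n → Bool := fun c => s (Fin.castAdd k c)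

/-- The restriction of a state of a union with `n + k` crossings to the last `k`. -/
def inner (n k : ℕ) (s : Fin (n + k) → Bool) : Fin k → Bool := fun c => s (Fin.natAdd n c)

/-- `-1` to the number of pairs of ones whose order is reversed by the relabelling `cr`. -/
def Isotopy.sign {D D' : LinkDiagram} (e : Isotopy D D') (s : D.State) : ℤ :=
  (-1) ^ (Finset.univ.filter fun x : Fin D.piece.n × Fin D.piece.n =>
    x.1 < x.2 ∧ e.cr x.2 < e.cr x.1 ∧ s x.1 = true ∧ s x.2 = true).card

/-- The isotopy, relative to the outside, between crossingless diagrams that have the same outside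
part and possibly different inner points, and no circle on inner points only. -/
def isoRel [Finite P] {k : ℕ} (r r' : P ⊕ Fin k → P ⊕ Fin k → Prop) :
    StateSpace r →ₗ[R] StateSpace r' :=
  let r₀ : P → P → Prop := fun x y => Quot.mk r (.inl x) = Quot.mk r (.inl y)
  pushMap Sum.inl r₀ r' ∘ₗ pullMap Sum.inl r₀ r

/-- The inclusion `F` of the homotopy equivalence for a bigon with two strands. Here `r` is the
crossingless diagram without the bigon, `r₀` is the result of a surgery on the two strands of `r`,
with `x` and `y` on different strands before and after, `r'` is the smoothing `v` of the bigon. The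
smoothing `01` is isotopic to `r`, the smoothing `10` is isotopic to `r₀` with a circle. -/
def bigonF [Finite P] {k : ℕ} (r r₀ : P → P → Prop) (x y : P)
    (r' : P ⊕ Fin k → P ⊕ Fin k → Prop) (v : Bool × Bool) : StateSpace r →ₗ[R] StateSpace r' :=
  match v with
  | (false, true) => pushMap Sum.inl r r'
  | (true, false) => pushMap Sum.inl r₀ r' ∘ₗ Khov.saddle r r₀ x y
  | _ => 0

/-- The retraction `G` of the homotopy equivalence for a bigon. -/
def bigonG [Finite P] {k : ℕ} (r r₀ : P → P → Prop) (x y : P)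
    (r' : P ⊕ Fin k → P ⊕ Fin k → Prop) (v : Bool × Bool) : StateSpace r' →ₗ[R] StateSpace r :=
  match v with
  | (false, true) => pullMap Sum.inl r r'
  | (true, false) => -(Khov.saddle r₀ r x y ∘ₗ pullMap Sum.inl r₀ r')
  | _ => 0

/-- The homotopy for a bigon, between `id` and `F ∘ G`, from the smoothing `r'`, in the state `v`,
to the smoothing `r''`, in the state `w`: the death of the circle from `10` to `00`, and minus its
birth from `11` to `10`. -/
def bigonH [Finite P] {k : ℕ} (r₀ : P → P → Prop) (r' r'' : P ⊕ Fin k → P ⊕ Fin k → Prop)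
    (v w : Bool × Bool) : StateSpace r' →ₗ[R] StateSpace r'' :=
  match v, w with
  | (true, false), (false, false) => pushMap Sum.inl r₀ r'' ∘ₗ pullMap Sum.inl r₀ r'
  | (true, true), (true, false) => -(pushMap Sum.inl r₀ r'' ∘ₗ pullMap Sum.inl r₀ r')
  | _, _ => 0

section Triangle

variable [Finite P] (O : Piece P) (p : Fin 6 → P) (mid : Bool) (s₀ : Fin O.n → Bool)

/-- The smoothing of a triangle, with the state `s₀` outside, the state `v` at the crossings of the
strand 0 and the state `b` at the other crossing. -/
def triRel (side : Bool) (v : Bool × Bool) (b : Bool) : P ⊕ Fin 3 → P ⊕ Fin 3 → Prop :=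
  ((O.map Sum.inl).append (trianglePiece mid side p (fun _ => true) fun _ => true)).smoothing
    (Fin.append s₀ ![v.1, v.2, b])

/-- The crossingless diagram to which the bigon under the strand 0 is simplified. -/
def triMiddle : P → P → Prop :=
  addJoins (O.smoothing s₀) [(p 0, p 3), (p 1, p 2), (p 4, p 5)]

/-- The result of the surgery on the two strands of the bigon. -/
def triSurgery (side : Bool) : P → P → Prop :=
  addJoins (O.smoothing s₀)
    (if side then [(p 0, p 5), (p 3, p 4), (p 1, p 2)] else [(p 0, p 1), (p 2, p 3), (p 4, p 5)])

/-- `F` for the bigon in the triangle. -/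
def triF (side : Bool) (r' : P ⊕ Fin 3 → P ⊕ Fin 3 → Prop) (v : Bool × Bool) :
    StateSpace (triMiddle O p s₀) →ₗ[R] StateSpace r' :=
  bigonF (triMiddle O p s₀) (triSurgery O p s₀ side) (p 0) (if side then p 4 else p 2) r' v

/-- `G` for the bigon in the triangle. -/
def triG (side : Bool) (r' : P ⊕ Fin 3 → P ⊕ Fin 3 → Prop) (v : Bool × Bool) :
    StateSpace r' →ₗ[R] StateSpace (triMiddle O p s₀) :=
  bigonG (triMiddle O p s₀) (triSurgery O p s₀ side) (p 0) (if side then p 4 else p 2) r' v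

/-- The saddle at the crossing of the strands 1 and 2, with its sign. -/
def triSaddle (side : Bool) (r r' : P ⊕ Fin 3 → P ⊕ Fin 3 → Prop) (v : Bool × Bool) :
    StateSpace r →ₗ[R] StateSpace r' :=
  (if v.1 = v.2 then (1 : ℤ) else -1) •
    saddle r r' (((trianglePiece mid side p (fun _ => true) fun _ => true).crossing (2 : Fin 3)).pt 0)
      (((trianglePiece mid side p (fun _ => true) fun _ => true).crossing (2 : Fin 3)).pt 2)

/-- The isotopy that moves the strand 0 over the two strands of the smoothing without a bigon of the
crossing of the strands 1 and 2; it exchanges the two crossings of the strand 0, whence the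
sign. -/
def triIso (r r' : P ⊕ Fin 3 → P ⊕ Fin 3 → Prop) (v : Bool × Bool) :
    StateSpace r →ₗ[R] StateSpace r' :=
  (if v.1 = true ∧ v.2 = true then (-1 : ℤ) else 1) • isoRel r r'

/-- The entries of the map of the third Reidemeister move from the given side to the other, from the
smoothing `r` in the state `(v, b)` to the smoothing `r'` in the state `(v', b')`.

If `mid`, the crossing of the strands 1 and 2 has a bigon in its 0-smoothing, and the complexes are
the cones of the saddle from the 0-smoothing to the 1-smoothing. With the homotopy equivalence
`F, G` and the homotopy `H` for bigons, the isotopy `κ` and the saddle `ψ`, the map is `F' G` on the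
0-smoothing, `κ` on the 1-smoothing, and `- κ ψ H` from the 0-smoothing to the 1-smoothing.

Otherwise the bigon is in the 1-smoothing, and the map is `κ` on the 0-smoothing, `- F' G` on the
1-smoothing, and `- H' ψ' κ` from the 0-smoothing to the 1-smoothing. -/
def triEntry (side : Bool) (r r' : P ⊕ Fin 3 → P ⊕ Fin 3 → Prop) (v : Bool × Bool) (b : Bool)
    (v' : Bool × Bool) (b' : Bool) : StateSpace r →ₗ[R] StateSpace r' :=
  match mid, b, b' with
  | true, false, false => triF O p s₀ (!side) r' v' ∘ₗ triG O p s₀ side r v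
  | true, true, true => if v' = v.swap then triIso r r' v else 0
  | true, false, true =>
    -(triIso (triRel O p mid s₀ side v'.swap true) r' v'.swap ∘ₗ
      triSaddle p mid side (triRel O p mid s₀ side v'.swap false)
        (triRel O p mid s₀ side v'.swap true) v'.swap ∘ₗ
      bigonH (triSurgery O p s₀ side) r (triRel O p mid s₀ side v'.swap false) v v'.swap)
  | false, false, false => if v' = v.swap then triIso r r' v else 0
  | false, true, true => -(triF O p s₀ (!side) r' v' ∘ₗ triG O p s₀ side r v)
  | false, false, true =>
    -(bigonH (triSurgery O p s₀ (!side)) (triRel O p mid s₀ (!side) v.swap true) r' v.swap v' ∘ₗ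
      triSaddle p mid (!side) (triRel O p mid s₀ (!side) v.swap false)
        (triRel O p mid s₀ (!side) v.swap true) v.swap ∘ₗ
      triIso r (triRel O p mid s₀ (!side) v.swap false) v)
  | _, true, false => 0

end Triangle

/-- The inclusion for a kink with a positive crossing. Here `q` is the diagram without the kink,
`q₁` is the smoothing of the kink isotopic to `q`, `q₀` is the smoothing with a circle through the
point `c`, and `a` is a point on the other strand of `q₀`. The map is the split of a circle off the
strand, minus the birth of a circle together with the attachment of a handle to the strand. -/
def posKinkF [Finite P] (q : P → P → Prop) (q₁ q₀ : P ⊕ Fin 1 → P ⊕ Fin 1 → Prop)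
    (c a : P ⊕ Fin 1) : StateSpace q →ₗ[R] StateSpace q₀ :=
  (saddle q₁ q₀ c a -
    (pushMap Sum.inl q q₀ ∘ₗ pullMap Sum.inl q q₁) ∘ₗ saddle q₀ q₁ c a ∘ₗ saddle q₁ q₀ c a) ∘ₗ
      pushMap Sum.inl q q₁

/-- The retraction for a kink with a negative crossing. Here `q` is the diagram without the kink,
`q₀` is the smoothing of the kink isotopic to `q`, `q₁` is the smoothing with a circle through the
point `c`, and `a` is a point on the other strand of `q₁`. The map is the merging of the circle with
the strand, minus the death of the circle together with the attachment of a handle to the strand. -/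
def negKinkG [Finite P] (q : P → P → Prop) (q₀ q₁ : P ⊕ Fin 1 → P ⊕ Fin 1 → Prop)
    (c a : P ⊕ Fin 1) : StateSpace q₁ →ₗ[R] StateSpace q :=
  pullMap Sum.inl q q₀ ∘ₗ (saddle q₁ q₀ c a -
    saddle q₁ q₀ c a ∘ₗ saddle q₀ q₁ c a ∘ₗ (pushMap Sum.inl q q₀ ∘ₗ pullMap Sum.inl q q₁))

open Classical in
/-- The map of an elementary move. -/
def Elementary.fwd {D D' : LinkDiagram} : Elementary D D' → Mat D D'
  | @Elementary.isotopy D D' e => fun s s' =>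
    if s' ∘ e.cr = s then e.sign s • pushMap e.point _ _ else 0
  | @Elementary.subdivide _ _ O _ _ _ _ => fun s s' =>
    if outer O.n 0 s' = s then pushMap Sum.inl _ _ else 0
  | @Elementary.posKink P _ O a b _ _ _ _ _ => fun s s' =>
    if outer O.n 1 s' = outer O.n 0 s ∧ inner O.n 1 s' 0 = false then
      posKinkF _ (addJoins ((O.map (Sum.inl : P → P ⊕ Fin 1)).smoothing (outer O.n 0 s))
        [(.inr 0, .inl b), (.inr 0, .inl a)]) _ (.inr 0) (.inl a)
    else 0
  | @Elementary.negKink _ _ O _ _ _ _ _ _ _ => fun s s' =>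
    if outer O.n 1 s' = outer O.n 0 s ∧ inner O.n 1 s' 0 = true then pushMap Sum.inl _ _ else 0
  | @Elementary.bigon _ _ O a b c d _ _ _ _ _ _ _ _ => fun s s' =>
    if outer O.n 2 s' = outer O.n 0 s then
      bigonF _ (addJoins (O.smoothing (outer O.n 0 s)) [(a, c), (b, d)]) a d _
        (inner O.n 2 s' 0, inner O.n 2 s' 1)
    else 0
  | @Elementary.triangle _ _ O mid side p _ _ _ _ _ _ => fun s s' =>
    if outer O.n 3 s' = outer O.n 3 s then
      triEntry O p mid (outer O.n 3 s) side _ _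
        (inner O.n 3 s 0, inner O.n 3 s 1) (inner O.n 3 s 2)
        (inner O.n 3 s' 0, inner O.n 3 s' 1) (inner O.n 3 s' 2)
    else 0
  | @Elementary.cup _ _ O _ _ _ => fun s s' =>
    if outer O.n 0 s' = s then pushMap Sum.inl _ _ else 0
  | @Elementary.saddle _ _ O a _ c _ _ _ _ _ _ _ _ => fun s s' =>
    if outer O.n 0 s' = outer O.n 0 s then Khov.saddle _ _ a c else 0

open Classical in
/-- The map of the reverse of an elementary move. -/
def Elementary.bwd {D D' : LinkDiagram} : Elementary D D' → Mat D' D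
  | @Elementary.isotopy D D' e => fun s' s =>
    if s' ∘ e.cr = s then e.sign s • pullMap e.point _ _ else 0
  | @Elementary.subdivide _ _ O _ _ _ _ => fun s' s =>
    if outer O.n 0 s' = s then pullMap Sum.inl _ _ else 0
  | @Elementary.posKink _ _ O _ _ _ _ _ _ _ => fun s' s =>
    if outer O.n 1 s' = outer O.n 0 s ∧ inner O.n 1 s' 0 = false then pullMap Sum.inl _ _ else 0
  | @Elementary.negKink P _ O a b _ _ _ _ _ => fun s' s =>
    if outer O.n 1 s' = outer O.n 0 s ∧ inner O.n 1 s' 0 = true then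
      negKinkG _ (addJoins ((O.map (Sum.inl : P → P ⊕ Fin 1)).smoothing (outer O.n 0 s))
        [(.inl a, .inr 0), (.inr 0, .inl b)]) _ (.inr 0) (.inl a)
    else 0
  | @Elementary.bigon _ _ O a b c d _ _ _ _ _ _ _ _ => fun s' s =>
    if outer O.n 2 s' = outer O.n 0 s then
      bigonG _ (addJoins (O.smoothing (outer O.n 0 s)) [(a, c), (b, d)]) a d _
        (inner O.n 2 s' 0, inner O.n 2 s' 1)
    else 0
  | @Elementary.triangle _ _ O mid side p _ _ _ _ _ _ => fun s' s =>
    if outer O.n 3 s' = outer O.n 3 s then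
      triEntry O p mid (outer O.n 3 s) (!side) _ _
        (inner O.n 3 s' 0, inner O.n 3 s' 1) (inner O.n 3 s' 2)
        (inner O.n 3 s 0, inner O.n 3 s 1) (inner O.n 3 s 2)
    else 0
  | @Elementary.cup _ _ O _ _ _ => fun s' s =>
    if outer O.n 0 s' = s then pullMap Sum.inl _ _ else 0
  | @Elementary.saddle _ _ O a _ c _ _ _ _ _ _ _ _ => fun s' s =>
    if outer O.n 0 s' = outer O.n 0 s then Khov.saddle _ _ a c else 0

/-! ## Movies -/

/-- A link cobordism represented as a movie: a finite sequence of link diagrams, any two consecutive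
ones being related by an elementary move or by the reverse of one. -/
inductive Movie : LinkDiagram → LinkDiagram → Type 1
  | nil (D : LinkDiagram) : Movie D D
  | fwd {D D₁ D' : LinkDiagram} (S : Movie D D₁) (e : Elementary D₁ D') : Movie D D'
  | bwd {D D₁ D' : LinkDiagram} (S : Movie D D₁) (e : Elementary D' D₁) : Movie D D'

/-- The cobordism map of a movie, the composition of the maps of its moves. -/
def Movie.cobMap {D D' : LinkDiagram} (S : Movie D D') (i : ℤ) : CKh D i →ₗ[R] CKh D' i :=
  match S with
  | .nil _ => LinearMap.id
  | .fwd S e => e.fwd.toLin i i ∘ₗ S.cobMap i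
  | .bwd S e => e.bwd.toLin i i ∘ₗ S.cobMap i

end Khov

end

/-!
The involution `σ̂` respects every structure map of the Frobenius algebra `A`: it is a ring
homomorphism, and it is compatible with the counit (`counit_sigma1`) and with the comultiplication
(`productMap_comul_sigma1`), both of which are checked on the `R`-basis `1, X` of `A`. Consequently
it commutes with the maps `mergeBirth`, `death` and `split` of tensor powers of `A`, each of which
is a product of such structure maps over the circles (`equivariant_prodMap`).

The linear maps that commute with `σ̂` contain zero and the identity and are stable under sums,
integer multiples and compositions. The entries of the differential and of the maps of the
elementary moves are all built in this way from `mergeBirth`, `death` and `split`, with only integer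
coefficients, so that they commute with `σ̂`. Nothing about the geometry of the diagrams is used.
-/

namespace Khov

/-! ### The involutions on the ground ring and on the Frobenius algebra -/

theorem exists_eq_add_smul_X (x : A) : ∃ a b : R, x = a • (1 : A) + b • X := by
  induction x using AdjoinRoot.induction_on with
  | ih p =>
    have hd : (p.modByMonic quad).degree ≤ 1 := by
      have hlt := Polynomial.degree_modByMonic_lt p quad_monic
      rw [quad_degree] at hlt
      exact Order.le_of_lt_succ hlt
    have hp : AdjoinRoot.mk quad p = AdjoinRoot.mk quad (p.modByMonic quad) := by
      rw [AdjoinRoot.mk_eq_mk]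
      exact ⟨p.divByMonic quad, by
        linear_combination -Polynomial.modByMonic_add_div p quad⟩
    refine ⟨(p.modByMonic quad).coeff 0, (p.modByMonic quad).coeff 1, ?_⟩
    rw [hp, Polynomial.eq_X_add_C_of_degree_le_one hd]
    simp [X, Algebra.smul_def, AdjoinRoot.algebraMap_eq, add_comm]

theorem sigma0_sigma0 (r : R) : sigma0 (sigma0 r) = r := by
  have key : sigma0.comp sigma0 = RingHom.id R := by
    refine MvPolynomial.ringHom_ext (fun c => by simp) fun k => ?_
    fin_cases k
    · change sigma0 (sigma0 h) = h
      rw [sigma0_h, map_neg, sigma0_h, neg_neg]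
    · change sigma0 (sigma0 t) = t
      rw [sigma0_t, sigma0_t]
  exact congrArg (fun f : R →+* R => f r) key

theorem sigma0_of_mem_R' {r : R} (hr : r ∈ R') : sigma0 r = r := by
  induction hr using Algebra.adjoin_induction with
  | mem x hx =>
    obtain rfl | rfl := hx
    · rw [map_pow, sigma0_h, neg_sq]
    · exact sigma0_t
  | algebraMap c => simp
  | add x y _ _ hx hy => rw [map_add, hx, hy]
  | mul x y _ _ hx hy => rw [map_mul, hx, hy]

theorem sigma1_X_eq_sub_smul : sigma1 X = X - h • (1 : A) := by
  rw [sigma1_X, Algebra.algebraMap_eq_smul_one]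

theorem sigma1_sigma1 (x : A) : sigma1 (sigma1 x) = x := by
  obtain ⟨a, b, rfl⟩ := exists_eq_add_smul_X x
  simp only [map_add, map_sub, sigma1_smul, map_one, sigma1_X_eq_sub_smul, sigma0_sigma0, sigma0_h]
  module

theorem counit_sigma1 (x : A) : counit (sigma1 x) = sigma0 (counit x) := by
  obtain ⟨a, b, rfl⟩ := exists_eq_add_smul_X x
  simp [sigma1_smul, sigma1_X_eq_sub_smul, counit_one, counit_X]

/-! ### The involution on tensor powers -/

theorem sigmaTP_one (C : Type) : sigmaTP C 1 = 1 := by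
  rw [PiTensorProduct.one_def, sigmaTP_tprod]
  simp only [Pi.one_apply, map_one]
  rfl

theorem sigmaTP_mul (C : Type) (x y : TP C) :
    sigmaTP C (x * y) = sigmaTP C x * sigmaTP C y := by
  induction x using PiTensorProduct.induction_on with
  | smul_tprod r a =>
    induction y using PiTensorProduct.induction_on with
    | smul_tprod s b =>
      simp only [smul_mul_smul_comm, map_smulₛₗ, PiTensorProduct.tprod_mul_tprod, sigmaTP_tprod,
        map_mul, Pi.mul_apply]
      rfl
    | add y z hy hz => rw [mul_add, map_add, hy, hz, map_add, mul_add]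
  | add x z hx hz => rw [add_mul, map_add, hx, hz, map_add, add_mul]

/-- `σ̂` on a tensor power of `A`, as a ring homomorphism. -/
noncomputable def sigmaRingHom (C : Type) : TP C →+* TP C where
  toFun := sigmaTP C
  map_one' := sigmaTP_one C
  map_mul' := sigmaTP_mul C
  map_zero' := map_zero _
  map_add' := map_add _

theorem sigmaTP_sigmaTP (C : Type) (x : TP C) : sigmaTP C (sigmaTP C x) = x := by
  induction x using PiTensorProduct.induction_on with
  | smul_tprod r a => simp only [map_smulₛₗ, sigmaTP_tprod, sigma1_sigma1, sigma0_sigma0]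
  | add x y hx hy => rw [map_add, map_add, hx, hy]

theorem sigmaTP_single {C : Type} (c : C) (x : A) :
    sigmaTP C (single c x) = single c (sigma1 x) := by
  classical
  simp only [single, PiTensorProduct.singleAlgHom_apply, sigmaTP_tprod]
  congr 1
  funext k
  by_cases hk : k = c
  · subst hk; simp
  · change sigma1 (Pi.mulSingle (M := fun _ : C => A) c x k) =
      Pi.mulSingle (M := fun _ : C => A) c (sigma1 x) k
    rw [Pi.mulSingle_eq_of_ne hk, Pi.mulSingle_eq_of_ne hk, map_one]

/-- The comultiplication is compatible with `σ̂`, whichever tensor factors its result is put in. -/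
theorem productMap_comul_sigma1 {C : Type} (p q : C) (x : A) :
    Algebra.TensorProduct.productMap (single p) (single q) (comul (sigma1 x)) =
      sigmaTP C (Algebra.TensorProduct.productMap (single p) (single q) (comul x)) := by
  obtain ⟨a, b, rfl⟩ := exists_eq_add_smul_X x
  simp only [map_add, map_sub, map_smul, map_smulₛₗ, map_one, comul_one, comul_X,
    sigma1_smul, sigma1_X_eq_sub_smul, Algebra.TensorProduct.productMap_apply_tmul, sigmaTP_mul,
    sigmaTP_single, sigmaTP_one, sigma0_h, sigma0_t, one_mul, mul_one]
  simp only [Algebra.smul_def, map_neg, mul_one]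
  ring

/-! ### Linear maps that commute with the involution -/

/-- The linear map `f` between tensor powers of `A` commutes with `σ̂`. -/
def Equivariant {C C' : Type} (f : TP C →ₗ[R] TP C') : Prop :=
  ∀ x, f (sigmaTP C x) = sigmaTP C' (f x)

section Closure

variable {C C' C'' : Type}

theorem Equivariant.zero : Equivariant (0 : TP C →ₗ[R] TP C') := fun x => by simp

theorem Equivariant.comp {g : TP C' →ₗ[R] TP C''} {f : TP C →ₗ[R] TP C'} (hg : Equivariant g)
    (hf : Equivariant f) : Equivariant (g ∘ₗ f) := fun x => by
  rw [LinearMap.comp_apply, hf, hg, LinearMap.comp_apply]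

theorem Equivariant.neg {f : TP C →ₗ[R] TP C'} (hf : Equivariant f) : Equivariant (-f) :=
  fun x => by rw [LinearMap.neg_apply, hf, LinearMap.neg_apply, map_neg]

theorem Equivariant.sub {f g : TP C →ₗ[R] TP C'} (hf : Equivariant f) (hg : Equivariant g) :
    Equivariant (f - g) :=
  fun x => by rw [LinearMap.sub_apply, hf, hg, LinearMap.sub_apply, map_sub]

theorem Equivariant.zsmul {f : TP C →ₗ[R] TP C'} (n : ℤ) (hf : Equivariant f) :
    Equivariant (n • f) :=
  fun x => by
    have key (y : TP C) : (n • f) y = n • f y := map_zsmul (LinearMap.applyₗ (R := R) y) n f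
    rw [key, hf, key, map_zsmul]

theorem Equivariant.sum {ι : Type} {s : Finset ι} {f : ι → TP C →ₗ[R] TP C'}
    (hf : ∀ k ∈ s, Equivariant (f k)) : Equivariant (∑ k ∈ s, f k) := fun x => by
  rw [LinearMap.sum_apply, LinearMap.sum_apply, map_sum]
  exact Finset.sum_congr rfl fun k hk => hf k hk x

theorem Equivariant.ite {P : Prop} [Decidable P] {f g : TP C →ₗ[R] TP C'} (hf : Equivariant f)
    (hg : Equivariant g) : Equivariant (if P then f else g) := by
  split_ifs
  exacts [hf, hg]

end Closure

/-- A product over the circles of maps that are compatible with `σ̂` commutes with `σ̂`, because `σ̂`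
is multiplicative. -/
theorem equivariant_prodMap {C C' : Type} [Finite C] {F : C → A →ₗ[R] TP C'}
    (hF : ∀ c x, F c (sigma1 x) = sigmaTP C' (F c x)) : Equivariant (prodMap F) := by
  intro x
  let _ := Fintype.ofFinite C
  have key (a : C → A) : prodMap F (PiTensorProduct.tprod R a) = ∏ c, F c (a c) := by
    simp only [prodMap, PiTensorProduct.lift.tprod, MultilinearMap.compLinearMap_apply,
      MultilinearMap.mkPiAlgebra_apply]
  induction x using PiTensorProduct.induction_on with
  | smul_tprod r a =>
    simp only [map_smulₛₗ, sigmaTP_tprod, key, hF]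
    exact congrArg (sigma0 r • ·) (map_prod (sigmaRingHom C') (fun c => F c (a c)) _).symm
  | add x y hx hy => rw [map_add, map_add, hx, hy, map_add, map_add]

theorem equivariant_mergeBirth {C C' : Type} [Finite C] (f : C → C') :
    Equivariant (mergeBirth f) :=
  equivariant_prodMap fun c x => (sigmaTP_single (f c) x).symm

theorem equivariant_death {C C' : Type} [Finite C'] (f : C → C') : Equivariant (death f) := by
  refine equivariant_prodMap fun c x => ?_
  split_ifs with e
  · exact (sigmaTP_single _ x).symm
  · simp only [LinearMap.comp_apply, Algebra.linearMap_apply, counit_sigma1,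
      Algebra.algebraMap_eq_smul_one, map_smulₛₗ, sigmaTP_one]

theorem equivariant_split {C C' : Type} [Finite C] (f : C → C') (c₀ : C) (p q : C') :
    Equivariant (split f c₀ p q) := by
  refine equivariant_prodMap fun c x => ?_
  split_ifs
  · exact productMap_comul_sigma1 p q x
  · exact (sigmaTP_single _ x).symm

/-! ### Cobordism maps between crossingless diagrams -/

section Cobordism

variable {P Q : Type}

theorem equivariant_pushMap [Finite P] (g : P → Q) (r : P → P → Prop) (r' : Q → Q → Prop) :
    Equivariant (pushMap g r r') :=
  equivariant_mergeBirth _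

theorem equivariant_pullMap [Finite Q] (g : P → Q) (r : P → P → Prop) (r' : Q → Q → Prop) :
    Equivariant (pullMap g r r') :=
  equivariant_death _

theorem equivariant_saddle [Finite P] (r r' : P → P → Prop) (a c : P) :
    Equivariant (saddle r r' a c) := by
  classical
  rw [saddle]
  exact .ite (equivariant_mergeBirth _) (.ite (equivariant_split _ _ _ _) .zero)

variable [Finite P]

theorem equivariant_isoRel {k : ℕ} (r r' : P ⊕ Fin k → P ⊕ Fin k → Prop) :
    Equivariant (isoRel r r') :=
  (equivariant_pushMap _ _ _).comp (equivariant_pullMap _ _ _)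

theorem equivariant_bigonF {k : ℕ} (r r₀ : P → P → Prop) (x y : P)
    (r' : P ⊕ Fin k → P ⊕ Fin k → Prop) (v : Bool × Bool) : Equivariant (bigonF r r₀ x y r' v) := by
  unfold bigonF
  split
  · exact equivariant_pushMap _ _ _
  · exact (equivariant_pushMap _ _ _).comp (equivariant_saddle _ _ _ _)
  · exact .zero

theorem equivariant_bigonG {k : ℕ} (r r₀ : P → P → Prop) (x y : P)
    (r' : P ⊕ Fin k → P ⊕ Fin k → Prop) (v : Bool × Bool) : Equivariant (bigonG r r₀ x y r' v) := by
  unfold bigonG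
  split
  · exact equivariant_pullMap _ _ _
  · exact ((equivariant_saddle _ _ _ _).comp (equivariant_pullMap _ _ _)).neg
  · exact .zero

theorem equivariant_bigonH {k : ℕ} (r₀ : P → P → Prop) (r' r'' : P ⊕ Fin k → P ⊕ Fin k → Prop)
    (v w : Bool × Bool) : Equivariant (bigonH r₀ r' r'' v w) := by
  unfold bigonH
  split
  · exact (equivariant_pushMap _ _ _).comp (equivariant_pullMap _ _ _)
  · exact ((equivariant_pushMap _ _ _).comp (equivariant_pullMap _ _ _)).neg
  · exact .zero

theorem equivariant_triSaddle (p : Fin 6 → P) (mid side : Bool)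
    (r r' : P ⊕ Fin 3 → P ⊕ Fin 3 → Prop) (v : Bool × Bool) :
    Equivariant (triSaddle p mid side r r' v) :=
  (equivariant_saddle _ _ _ _).zsmul _

theorem equivariant_triIso (r r' : P ⊕ Fin 3 → P ⊕ Fin 3 → Prop) (v : Bool × Bool) :
    Equivariant (triIso r r' v) :=
  (equivariant_isoRel _ _).zsmul _

theorem equivariant_triEntry (O : Piece P) (p : Fin 6 → P) (mid : Bool) (s₀ : Fin O.n → Bool)
    (side : Bool) (r r' : P ⊕ Fin 3 → P ⊕ Fin 3 → Prop) (v : Bool × Bool) (b : Bool)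
    (v' : Bool × Bool) (b' : Bool) : Equivariant (triEntry O p mid s₀ side r r' v b v' b') := by
  have hFG : Equivariant (triF O p s₀ (!side) r' v' ∘ₗ triG O p s₀ side r v) :=
    (equivariant_bigonF _ _ _ _ _ _).comp (equivariant_bigonG _ _ _ _ _ _)
  unfold triEntry
  split
  · exact hFG
  · exact .ite (equivariant_triIso _ _ _) .zero
  · exact ((equivariant_triIso _ _ _).comp ((equivariant_triSaddle _ _ _ _ _ _).comp
      (equivariant_bigonH _ _ _ _ _))).neg
  · exact .ite (equivariant_triIso _ _ _) .zero
  · exact hFG.neg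
  · exact ((equivariant_bigonH _ _ _ _ _).comp ((equivariant_triSaddle _ _ _ _ _ _).comp
      (equivariant_triIso _ _ _))).neg
  · exact .zero

theorem equivariant_posKinkF (q : P → P → Prop) (q₁ q₀ : P ⊕ Fin 1 → P ⊕ Fin 1 → Prop)
    (c a : P ⊕ Fin 1) : Equivariant (posKinkF q q₁ q₀ c a) :=
  .comp (.sub (equivariant_saddle _ _ _ _)
    (.comp (.comp (equivariant_pushMap _ _ _) (equivariant_pullMap _ _ _))
      (.comp (equivariant_saddle _ _ _ _) (equivariant_saddle _ _ _ _))))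
    (equivariant_pushMap _ _ _)

theorem equivariant_negKinkG (q : P → P → Prop) (q₀ q₁ : P ⊕ Fin 1 → P ⊕ Fin 1 → Prop)
    (c a : P ⊕ Fin 1) : Equivariant (negKinkG q q₀ q₁ c a) :=
  .comp (equivariant_pullMap _ _ _) (.sub (equivariant_saddle _ _ _ _)
    (.comp (equivariant_saddle _ _ _ _) (.comp (equivariant_saddle _ _ _ _)
      (.comp (equivariant_pushMap _ _ _) (equivariant_pullMap _ _ _)))))

end Cobordism

/-! ### The Khovanov complex and the maps of movies -/

theorem CKh.sigma_apply (D : LinkDiagram) (i : ℤ) (x : CKh D i)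
    (s : {s : D.State // (D.weight s : ℤ) - D.piece.nMinus = i}) :
    CKh.sigma D i x s = sigmaTP _ (x s) :=
  rfl

theorem Mat.sigma_toLin {D D' : LinkDiagram} {M : Mat D D'} (hM : ∀ s s', Equivariant (M s s'))
    (i j : ℤ) (x : CKh D i) :
    CKh.sigma D' j (M.toLin i j x) = M.toLin i j (CKh.sigma D i x) := by
  funext s'
  simp only [CKh.sigma_apply, Mat.toLin, LinearMap.pi_apply, LinearMap.sum_apply, map_sum,
    LinearMap.comp_apply, LinearMap.proj_apply]
  exact Finset.sum_congr rfl fun s _ => (hM s.1 s'.1 (x s)).symm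

theorem equivariant_diffMat (D : LinkDiagram) (s s' : D.State) :
    Equivariant (diffMat D s s') :=
  .sum fun _ _ => .ite ((equivariant_saddle _ _ _ _).zsmul _) .zero

theorem Elementary.equivariant_fwd {D D' : LinkDiagram} (e : Elementary D D') (s : D.State)
    (s' : D'.State) : Equivariant (e.fwd s s') := by
  classical
  cases e with
  | isotopy e => exact .ite ((equivariant_pushMap _ _ _).zsmul _) .zero
  | subdivide => exact .ite (equivariant_pushMap _ _ _) .zero
  | posKink => exact .ite (equivariant_posKinkF _ _ _ _ _) .zero
  | negKink => exact .ite (equivariant_pushMap _ _ _) .zero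
  | bigon => exact .ite (equivariant_bigonF _ _ _ _ _ _) .zero
  | triangle => exact .ite (equivariant_triEntry _ _ _ _ _ _ _ _ _ _ _) .zero
  | cup => exact .ite (equivariant_pushMap _ _ _) .zero
  | saddle => exact .ite (equivariant_saddle _ _ _ _) .zero

theorem Elementary.equivariant_bwd {D D' : LinkDiagram} (e : Elementary D D') (s' : D'.State)
    (s : D.State) : Equivariant (e.bwd s' s) := by
  classical
  cases e with
  | isotopy e => exact .ite ((equivariant_pullMap _ _ _).zsmul _) .zero
  | subdivide => exact .ite (equivariant_pullMap _ _ _) .zero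
  | posKink => exact .ite (equivariant_pullMap _ _ _) .zero
  | negKink => exact .ite (equivariant_negKinkG _ _ _ _ _) .zero
  | bigon => exact .ite (equivariant_bigonG _ _ _ _ _ _) .zero
  | triangle => exact .ite (equivariant_triEntry _ _ _ _ _ _ _ _ _ _ _) .zero
  | cup => exact .ite (equivariant_pullMap _ _ _) .zero
  | saddle => exact .ite (equivariant_saddle _ _ _ _) .zero

theorem Movie.sigma_cobMap {D D' : LinkDiagram} (S : Movie D D') (i : ℤ) (x : CKh D i) :
    CKh.sigma D' i (S.cobMap i x) = S.cobMap i (CKh.sigma D i x) := by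
  induction S with
  | nil => rfl
  | fwd S e ih =>
    simp only [Movie.cobMap, LinearMap.comp_apply]
    rw [Mat.sigma_toLin e.equivariant_fwd, ih]
  | bwd S e ih =>
    simp only [Movie.cobMap, LinearMap.comp_apply]
    rw [Mat.sigma_toLin e.equivariant_bwd, ih]

end Khov

theorem mainTheorem4 {D D' : Khov.LinkDiagram} (S : Khov.Movie D D') :
    (∀ i : ℤ, ∀ x : Khov.CKh D i,
      Khov.CKh.sigma D i (Khov.CKh.sigma D i x) = x ∧
      (∀ r ∈ Khov.R', Khov.CKh.sigma D i (r • x) = r • Khov.CKh.sigma D i x) ∧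
      Khov.CKh.sigma D (i + 1) (Khov.CKh.d D i x) = Khov.CKh.d D i (Khov.CKh.sigma D i x)) ∧
    ∀ i : ℤ, ∀ x : Khov.CKh D i,
      Khov.CKh.sigma D' i (S.cobMap i x) = S.cobMap i (Khov.CKh.sigma D i x) := by
  refine ⟨fun i x => ⟨funext fun s => Khov.sigmaTP_sigmaTP _ (x s), fun r hr => ?_,
    Khov.Mat.sigma_toLin (Khov.equivariant_diffMat D) i (i + 1) x⟩, S.sigma_cobMap⟩
  rw [map_smulₛₗ, Khov.sigma0_of_mem_R' hr]
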